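/- Notation. For $v\in\mathbb R^d$ let $\operatorname{supp}(v)=\{i: v_i\neq 0\}$. For a matrix $X$ with $n$ rows and column index set $I$, and a subset $T\subseteq I$, let $X_T$ be the submatrix of the columns indexed by $T$, let $\mathbb C(T)=\{v\in\mathbb R^I:\|v_{I\setminus T}\|_1\le\|v_T\|_1\}$, and let $$\gamma_T(X)=\min_{v\in\mathbb C(T),\ v_T\ne 0}\frac{\frac1n\|Xv\|_2^2}{\|v_T\|_2^2}$$ be the restricted eigenvalue constant ($+\infty$ if $T=\emptyset$). A random matrix $X\in\mathbb R^{n\times d}$ is $(\epsilon,\delta)$-partially-rotated with respect to $S\subseteq[d]$ if for all fixed $a\in\mathbb R^{S}$ and $b\in\mathbb R^{S^c}$ $$\mathbb P\left(\left|\left\langle \frac{X_Sa}{\|X_Sa\|_2},\frac{X_{S^c}b}{\|X_{S^c}b\|_2}\right\rangle\right|>\epsilon\right)\le e^{-\delta n},$$ where the inner product is regarded as $0$ if $X_Sa=0$ or $X_{S^c}b=0$. Corollary 1.4 (Main result for Lasso). For every $c>0$ there is $c'>0$ depending only on $c$, and for every $A>0$ there is $C>0$ depending only on $c$ and $A$,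 such that the following holds. Let $n\ge1$, $d\ge2$, $k\ge 0$, $\sigma\ge0$, $S\subseteq[d]$, and let $\beta\in\mathbb R^d$ be a fixed vector with at most $k$ non-zero entries and $\operatorname{supp}(\beta)\subseteq S$. Let $X\in\mathbb R^{n\times d}$ be a random matrix whose columns almost surely have Euclidean norm $\sqrt n$ and which is $(0.01,c)$-partially-rotated with respect to $S$, let $w\sim N(0,\sigma^2 I_n)$ be independent of $X$, and let $y=X\beta+w$. Then, outside an event of probability at most $d^{-A}+e^{-c'n}$, every constrained Lasso estimate, that is, every minimizer $\hat\beta$ of $\|y-Xb\|_2^2$ over $b\in\mathbb R^d$ with $\|b\|_1\le\|\beta\|_1$, satisfies $$\frac1n\|X\hat\beta-X\beta\|_2^2\le C\,\frac{\sigma^2k\log d}{\gamma_{\operatorname{supp}(\beta)}(X_S)\cdot n}.$$ Here the quotient is taken in $[0,\infty]$: it is $0$ if the numerator is $0$, and $+\infty$ if the numerator is positive and $\gamma_{\operatorname{supp}(\beta)}(X_S)=0$. -/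

import Mathlib

open MeasureTheory ProbabilityTheory
open scoped ENNReal Matrix

namespace PartiallyRotated

/-- The submatrix `X_S` of the columns of `X` indexed by `S`. -/
def cols {m ι : Type*} (X : Matrix m ι ℝ) (S : Finset ι) : Matrix m S ℝ :=
  X.submatrix id Subtype.val

/-- The vector `X v`, as an element of Euclidean space (so that its norm is the `ℓ₂`-norm). -/
noncomputable def app {m ι : Type*} [Fintype ι] (X : Matrix m ι ℝ) (v : ι → ℝ) :
    EuclideanSpace ℝ m :=
  WithLp.toLp 2 (X *ᵥ v)

/-- The `ℓ₁`-norm of the restriction of `v` to the coordinates in `S`. -/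
noncomputable def l1On {ι : Type*} (S : Finset ι) (v : ι → ℝ) : ℝ :=
  ∑ i ∈ S, |v i|

/-- The `ℓ₁`-norm of `v`. -/
noncomputable def l1 {ι : Type*} [Fintype ι] (v : ι → ℝ) : ℝ :=
  l1On Finset.univ v

/-- The squared `ℓ₂`-norm of the restriction of `v` to the coordinates in `S`. -/
noncomputable def l2SqOn {ι : Type*} (S : Finset ι) (v : ι → ℝ) : ℝ :=
  ∑ i ∈ S, v i ^ 2

/-- The support of `v`. -/
noncomputable def supp {ι : Type*} [Fintype ι] (v : ι → ℝ) : Finset ι :=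
  Finset.univ.filter fun i => v i ≠ 0

/-- The cone `ℂ(S)` of the vectors `v` with `‖v_{Sᶜ}‖₁ ≤ ‖v_S‖₁`. -/
def cone {ι : Type*} [Fintype ι] [DecidableEq ι] (S : Finset ι) : Set (ι → ℝ) :=
  {v | l1On Sᶜ v ≤ l1On S v}

/-- The restricted eigenvalue constant `γ_S(X)` of a matrix `X` with `n` rows: the minimum over
`v ∈ ℂ(S)` with `v_S ≠ 0` of `(‖X v‖₂² / n) / ‖v_S‖₂²`. For nonempty `S` it is finite; for
`S = ∅` the minimum is over the empty set and the value is `∞`. -/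
noncomputable def reConst {n : ℕ} {ι : Type*} [Fintype ι] [DecidableEq ι]
    (X : Matrix (Fin n) ι ℝ) (S : Finset ι) : ℝ≥0∞ :=
  ⨅ v ∈ {v : ι → ℝ | v ∈ cone S ∧ l2SqOn S v ≠ 0},
    ENNReal.ofReal ((1 / (n : ℝ) * ‖app X v‖ ^ 2) / l2SqOn S v)

/-- The random matrix `X` is `(ε, δ)`-partially-rotated with respect to `S`. The normalization of
the zero vector is the zero vector, so the inner product is `0` if `X_S α = 0` or `X_{Sᶜ} β = 0`. -/
def IsPartiallyRotated {Ω : Type*} [MeasurableSpace Ω] (P : Measure Ω) {n d : ℕ}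
    (X : Ω → Matrix (Fin n) (Fin d) ℝ) (S : Finset (Fin d)) (ε δ : ℝ) : Prop :=
  ∀ (α : S → ℝ) (β : (Sᶜ : Finset (Fin d)) → ℝ),
    P {ω | ε < |inner ℝ (‖app (cols (X ω) S) α‖⁻¹ • app (cols (X ω) S) α)
                  (‖app (cols (X ω) Sᶜ) β‖⁻¹ • app (cols (X ω) Sᶜ) β)|}
      ≤ ENNReal.ofReal (Real.exp (-δ * n))

/-- `b` is a constrained Lasso estimate with `ℓ₁`-radius `r` for the design `X` and the
response `y`: a minimizer of `‖y - X b‖₂²` subject to `‖b‖₁ ≤ r`. -/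
def IsLasso {n d : ℕ} (X : Matrix (Fin n) (Fin d) ℝ) (y : EuclideanSpace ℝ (Fin n)) (r : ℝ)
    (b : Fin d → ℝ) : Prop :=
  l1 b ≤ r ∧ ∀ b' : Fin d → ℝ, l1 b' ≤ r → ‖y - app X b‖ ^ 2 ≤ ‖y - app X b'‖ ^ 2

end PartiallyRotated

/-! Put `v = b - β`. Minimality gives `‖Xv‖² ≤ 2⟨Xv, w⟩`, and the radius `‖β‖₁` puts `v` in the cone
of `supp β`. Write `Xv = u + z`, with `u` from the columns in `S` and `z` from the others. The
restricted eigenvalue of `X_S` bounds `‖v‖₁²` by `4k‖u‖²/(γn)`, so it remains to replace `‖u‖` by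
`‖Xv‖`, that is, to exclude cancellation between `u` and `z`.

Partial rotation controls only fixed coefficient vectors, whereas `v` depends on `X` and `w`.
Maurey's argument (`exists_app_signedCoeff_approx`) approximates `u` and `z` by scaled signed sums
of `s ≈ cn/(8 log d)` columns. There are at most `d^(4s) ≤ exp(cn/2)` pairs of such sums, so a union
bound makes all of them nearly orthogonal at once. If `k log d` is at most a small multiple of `γn`,
the approximation errors are at most `‖u‖/10`, and `‖u‖² ≤ 2‖Xv‖²` follows
(`SparselyIncoherent.norm_sq_le`). Then `⟨Xv, w⟩ ≤ max_j |⟨X_j, w⟩| ‖v‖₁` yields the rate. Otherwise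
the claimed bound is at least of order `σ²`, and `‖Xv‖ ≤ 2‖w‖` with a chi-square tail suffices. -/

namespace PartiallyRotated

/-! ### Maurey sparsification in an inner product space. -/

section Sparsification

variable {ι H : Type*} [Fintype ι] [NormedAddCommGroup H] [InnerProductSpace ℝ H]

/-- Averaging over `i` with weights `p i` kills the cross term with `D`, and the variance of `y` is
at most `M ^ 2`; some `i` does no worse than the average. This is the derandomized step of Maurey's
method, with `D` the error accumulated so far. -/
lemma exists_norm_add_sub_sq_le (p : ι → ℝ) (hp : ∀ i, 0 ≤ p i) (hp1 : ∑ i, p i = 1)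
    (y : ι → H) (M : ℝ) (hy : ∀ i, ‖y i‖ ≤ M) (D : H) :
    ∃ i, ‖D + ∑ j, p j • y j - y i‖ ^ 2 ≤ ‖D‖ ^ 2 + M ^ 2 := by
  set u := ∑ j, p j • y j with hu
  by_contra! h
  have h1 : ∑ i, p i * (‖D‖ ^ 2 + M ^ 2) < ∑ i, p i * ‖D + u - y i‖ ^ 2 := by
    have hne : ∃ i, 0 < p i := by
      by_contra! h0
      have : ∑ i, p i ≤ 0 := Finset.sum_nonpos fun i _ => h0 i
      linarith
    obtain ⟨i, hi⟩ := hne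
    exact Finset.sum_lt_sum (fun i _ => mul_le_mul_of_nonneg_left (h i).le (hp i))
      ⟨i, Finset.mem_univ _, mul_lt_mul_of_pos_left (h i) hi⟩
  have h2 : ∀ i, p i * ‖D + u - y i‖ ^ 2 ≤
      p i * (‖D + u‖ ^ 2 + M ^ 2) - 2 * inner ℝ (D + u) (p i • y i) := by
    intro i
    have h3 : ‖y i‖ ^ 2 ≤ M ^ 2 := pow_le_pow_left₀ (norm_nonneg _) (hy i) 2
    rw [norm_sub_sq_real, inner_smul_right]
    nlinarith [mul_le_mul_of_nonneg_left h3 (hp i)]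
  have h4 := h1.trans_le (Finset.sum_le_sum fun i _ => h2 i)
  rw [Finset.sum_sub_distrib, ← Finset.sum_mul, ← Finset.sum_mul, hp1, ← Finset.mul_sum,
    ← inner_sum, ← hu, norm_add_sq_real, inner_add_left, real_inner_self_eq_norm_sq] at h4
  nlinarith [sq_nonneg ‖u‖]

/-- The sign `±1` encoded by a Boolean. -/
def boolSign (b : Bool) : ℝ := if b then 1 else -1

/-- Maurey's empirical approximation of a linear combination by a sum of `s` signed vectors. -/
lemma exists_signed_sum_approx (x : ι → H) (M : ℝ) (hx : ∀ i, ‖x i‖ ≤ M) (a : ι → ℝ)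
    (ha : 0 < ∑ i, |a i|) (s : ℕ) :
    ∃ f : Fin s → ι × Bool,
      ‖(s : ℝ) • ∑ i, a i • x i - (∑ i, |a i|) • ∑ j, boolSign (f j).2 • x (f j).1‖ ^ 2
        ≤ s * ((∑ i, |a i|) * M) ^ 2 := by
  set r := ∑ i, |a i| with hr
  induction s with
  | zero => exact ⟨Fin.elim0, by simp⟩
  | succ s ih =>
    obtain ⟨f, hf⟩ := ih
    let b : ι → Bool := fun i => decide (0 ≤ a i)
    have hb : ∀ i, |a i| * boolSign (b i) = a i := by
      intro i
      by_cases h : 0 ≤ a i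
      · simp [b, boolSign, h]
      · simp [b, boolSign, h, abs_of_neg (not_le.1 h)]
    have hb1 : ∀ i, |boolSign (b i)| = 1 := by
      intro i; unfold boolSign; split_ifs <;> simp
    -- Sampling `i` with probability `|a i| / r` and taking `r` times the signed vector has mean `∑
    -- a i • x i`.
    obtain ⟨i, hi⟩ := exists_norm_add_sub_sq_le (fun i => |a i| / r) (fun i => by positivity)
      (by rw [← Finset.sum_div, ← hr, div_self ha.ne'])
      (fun i => (r * boolSign (b i)) • x i) (r * M)
      (fun i => by
        rw [norm_smul, Real.norm_eq_abs, abs_mul, hb1, mul_one, abs_of_pos ha]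
        exact mul_le_mul_of_nonneg_left (hx i) ha.le)
      ((s : ℝ) • ∑ i, a i • x i - r • ∑ j, boolSign (f j).2 • x (f j).1)
    have hsum : ∑ j, (|a j| / r) • (r * boolSign (b j)) • x j = ∑ i, a i • x i := by
      refine Finset.sum_congr rfl fun j _ => ?_
      rw [smul_smul, ← mul_assoc, div_mul_cancel₀ _ ha.ne', hb]
    refine ⟨Fin.snoc f (i, b i), ?_⟩
    rw [Fin.sum_univ_castSucc]
    simp only [Fin.snoc_castSucc, Fin.snoc_last]
    rw [hsum] at hi
    have he : ((s + 1 : ℕ) : ℝ) • ∑ i, a i • x i -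
        r • (∑ j, boolSign (f j).2 • x (f j).1 + boolSign (b i) • x i) =
        (s : ℝ) • ∑ i, a i • x i - r • ∑ j, boolSign (f j).2 • x (f j).1
          + ∑ i, a i • x i - (r * boolSign (b i)) • x i := by
      push_cast
      rw [add_smul, one_smul, smul_add, smul_smul]
      abel
    rw [he]
    push_cast
    linarith

/-- The coefficient vector of a sum of signed basis vectors. -/
noncomputable def signedCoeff {s : ℕ} (f : Fin s → ι × Bool) : ι → ℝ :=
  ∑ j, boolSign (f j).2 • (open Classical in Pi.single (f j).1 (1 : ℝ))

end Sparsification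

/-! ### Linearity of `X v` and sparsification for matrices. -/

section LinearAlgebra

variable {m ι : Type*} [Fintype ι]

lemma app_eq_sum (X : Matrix m ι ℝ) (v : ι → ℝ) :
    app X v = ∑ i, v i • WithLp.toLp 2 (X.col i) := by
  ext j
  simp [app, Matrix.mulVec, dotProduct, mul_comm]

lemma app_add (X : Matrix m ι ℝ) (v v' : ι → ℝ) : app X (v + v') = app X v + app X v' := by
  simp [app, Matrix.mulVec_add]

lemma app_sub (X : Matrix m ι ℝ) (v v' : ι → ℝ) : app X (v - v') = app X v - app X v' := by
  simp [app, Matrix.mulVec_sub]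

lemma app_zero (X : Matrix m ι ℝ) : app X 0 = 0 := by
  simp [app]

lemma app_smul (X : Matrix m ι ℝ) (t : ℝ) (v : ι → ℝ) : app X (t • v) = t • app X v := by
  simp [app, Matrix.mulVec_smul]

lemma app_single [DecidableEq ι] (X : Matrix m ι ℝ) (i : ι) :
    app X (Pi.single i 1) = WithLp.toLp 2 (X.col i) := by
  simp [app]

lemma app_signedCoeff (X : Matrix m ι ℝ) {s : ℕ} (f : Fin s → ι × Bool) :
    app X (signedCoeff f) = ∑ j, boolSign (f j).2 • WithLp.toLp 2 (X.col (f j).1) := by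
  classical
  let L : (ι → ℝ) →ₗ[ℝ] EuclideanSpace ℝ m :=
    { toFun := app X, map_add' := app_add X, map_smul' := app_smul X }
  change L _ = _
  rw [signedCoeff, map_sum]
  refine Finset.sum_congr rfl fun j _ => ?_
  rw [map_smul]
  congr 1
  change app X _ = _
  convert app_single X (f j).1

lemma app_eq_cols_add_cols_compl [DecidableEq ι] (X : Matrix m ι ℝ) (S : Finset ι) (v : ι → ℝ) :
    app X v = app (cols X S) (fun i => v i) + app (cols X Sᶜ) (fun i => v i) := by
  simp only [app_eq_sum]
  rw [← Finset.sum_add_sum_compl S, ← Finset.sum_coe_sort S, ← Finset.sum_coe_sort Sᶜ]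
  rfl

variable [Fintype m]

/-- Sparsification of `X v` for a matrix with columns of norm at most `M`. -/
lemma exists_app_signedCoeff_approx (X : Matrix m ι ℝ) (M : ℝ)
    (hX : ∀ i, ‖WithLp.toLp 2 (X.col i)‖ ≤ M) (v : ι → ℝ) (hv : 0 < l1 v) {s : ℕ} (hs : 0 < s) :
    ∃ f : Fin s → ι × Bool,
      ‖app X v - (l1 v / s) • app X (signedCoeff f)‖ ^ 2 ≤ (l1 v * M) ^ 2 / s := by
  have hs' : (0 : ℝ) < s := by exact_mod_cast hs
  obtain ⟨f, hf⟩ := exists_signed_sum_approx (fun i => WithLp.toLp 2 (X.col i)) M hX v hv s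
  refine ⟨f, ?_⟩
  rw [← app_eq_sum, ← app_signedCoeff] at hf
  change ‖(s : ℝ) • app X v - l1 v • app X (signedCoeff f)‖ ^ 2 ≤ s * (l1 v * M) ^ 2 at hf
  have he : (s : ℝ) • app X v - l1 v • app X (signedCoeff f) =
      (s : ℝ) • (app X v - (l1 v / s) • app X (signedCoeff f)) := by
    rw [smul_sub, smul_smul, mul_div_cancel₀ _ hs'.ne']
  rw [he, norm_smul, mul_pow, Real.norm_eq_abs, sq_abs] at hf
  rw [le_div_iff₀ hs']
  nlinarith

end LinearAlgebra

/-! ### The `ℓ₁` cone and restriction to `S`. -/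

section EllOne

variable {ι : Type*}

/-- With `T = supp β`, `‖b_{Tᶜ}‖₁ ≤ ‖β_T‖₁ - ‖b_T‖₁ ≤ ‖(b - β)_T‖₁`. -/
lemma sub_mem_cone_supp [Fintype ι] [DecidableEq ι] {β b : ι → ℝ} (h : l1 b ≤ l1 β) :
    b - β ∈ cone (supp β) := by
  change l1On (supp β)ᶜ (b - β) ≤ l1On (supp β) (b - β)
  have h0 : ∀ i ∈ (supp β)ᶜ, β i = 0 := by
    intro i hi
    simpa [supp] using hi
  have h1 : l1On (supp β)ᶜ (b - β) = ∑ i ∈ (supp β)ᶜ, |b i| :=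
    Finset.sum_congr rfl fun i hi => by simp [h0 i hi]
  have h2 : ∑ i ∈ (supp β)ᶜ, |β i| = 0 := Finset.sum_eq_zero fun i hi => by simp [h0 i hi]
  have h3 : ∑ i ∈ supp β, |β i| ≤ ∑ i ∈ supp β, |b i| + l1On (supp β) (b - β) := by
    rw [l1On, ← Finset.sum_add_distrib]
    refine Finset.sum_le_sum fun i _ => ?_
    have := abs_sub_abs_le_abs_sub (β i) (b i)
    rw [abs_sub_comm] at this
    simp only [Pi.sub_apply]
    linarith
  unfold l1 l1On at h
  rw [← Finset.sum_add_sum_compl (supp β), ← Finset.sum_add_sum_compl (supp β) (fun i => |β i|)]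
    at h
  linarith

lemma l1On_sq_le (T : Finset ι) (v : ι → ℝ) : l1On T v ^ 2 ≤ T.card * l2SqOn T v := by
  have := sq_sum_le_card_mul_sum_sq (s := T) (f := fun i => |v i|)
  simpa [l1On, l2SqOn] using this

lemma l1_eq_zero [Fintype ι] {v : ι → ℝ} (h : l1 v ≤ 0) : v = 0 := by
  have h0 : l1 v = 0 := le_antisymm h (Finset.sum_nonneg fun i _ => abs_nonneg _)
  funext i
  simpa using (Finset.sum_eq_zero_iff_of_nonneg fun i _ => abs_nonneg (v i)).1 h0 i
    (Finset.mem_univ i)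

lemma l1On_nonneg (T : Finset ι) (v : ι → ℝ) : 0 ≤ l1On T v :=
  Finset.sum_nonneg fun _ _ => abs_nonneg _

lemma l2SqOn_nonneg (T : Finset ι) (v : ι → ℝ) : 0 ≤ l2SqOn T v :=
  Finset.sum_nonneg fun _ _ => sq_nonneg _

lemma l1On_add_compl [Fintype ι] [DecidableEq ι] (T : Finset ι) (v : ι → ℝ) :
    l1On T v + l1On Tᶜ v = l1 v :=
  Finset.sum_add_sum_compl T _

lemma l1_coe (S : Finset ι) (v : ι → ℝ) : l1 (fun i : S => v i) = l1On S v :=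
  Finset.sum_coe_sort S fun i => |v i|

lemma sum_subtype_of_subset [DecidableEq ι] {S T : Finset ι} (hT : T ⊆ S) (g : ι → ℝ) :
    ∑ i ∈ T.subtype (· ∈ S), g i = ∑ i ∈ T, g i := by
  rw [Finset.sum_subtype_eq_sum_filter, Finset.filter_true_of_mem fun i hi => hT hi]

/-- As `T ⊆ S`, dropping the coordinates outside `S` leaves the `T` part intact and can only shrink
the rest. -/
lemma mem_cone_restrict [Fintype ι] [DecidableEq ι] {S T : Finset ι} (hT : T ⊆ S) {v : ι → ℝ}
    (hv : v ∈ cone T) : (fun i : S => v i) ∈ cone (T.subtype (· ∈ S)) := by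
  have h1 : l1On (T.subtype (· ∈ S)) (fun i : S => v i) = l1On T v :=
    sum_subtype_of_subset hT fun i => |v i|
  have h2 := l1On_add_compl (T.subtype (· ∈ S)) (fun i : S => v i)
  have h3 := l1On_add_compl T v
  have h4 := l1On_add_compl S v
  have h5 := l1On_nonneg Sᶜ v
  rw [l1_coe] at h2
  change l1On _ _ ≤ l1On _ _ at hv
  change l1On _ _ ≤ l1On _ _
  linarith

end EllOne

/-- Near-orthogonality passes from `u'`, `z'` to `u`, `z`: the errors add to `|⟨u, z⟩|` only small
multiples of `‖u‖‖z‖` and `‖u‖²`. Both errors are measured against `‖u‖`, so `z` may be arbitrarily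
small or large. -/
lemma norm_sq_le_two_mul_norm_add_sq {H : Type*} [NormedAddCommGroup H] [InnerProductSpace ℝ H]
    {u z u' z' : H} (hu : ‖u - u'‖ ≤ ‖u‖ / 10) (hz : ‖z - z'‖ ≤ ‖u‖ / 10)
    (h : |inner ℝ u' z'| ≤ 0.01 * (‖u'‖ * ‖z'‖)) : ‖u‖ ^ 2 ≤ 2 * ‖u + z‖ ^ 2 := by
  have hu' : ‖u'‖ ≤ 11 / 10 * ‖u‖ := by
    have := norm_le_norm_add_norm_sub' u' u
    rw [norm_sub_rev] at this
    linarith [norm_sub_rev u u']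
  have hz' : ‖z'‖ ≤ ‖z‖ + ‖u‖ / 10 := by
    have := norm_le_norm_add_norm_sub' z' z
    linarith [norm_sub_rev z z']
  have h1 : inner ℝ u z = inner ℝ u' z' + inner ℝ (u - u') z' + inner ℝ u (z - z') := by
    rw [inner_sub_left, inner_sub_right]; ring
  have h2 := abs_le.1 (abs_real_inner_le_norm (u - u') z')
  have h3 := abs_le.1 (abs_real_inner_le_norm u (z - z'))
  have h4 := abs_le.1 h
  have nu := norm_nonneg u
  have nz := norm_nonneg z
  have h5 : ‖u - u'‖ * ‖z'‖ ≤ ‖u‖ / 10 * (‖z‖ + ‖u‖ / 10) := by gcongr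
  have h6 : ‖u‖ * ‖z - z'‖ ≤ ‖u‖ * (‖u‖ / 10) := by gcongr
  have h7 : ‖u'‖ * ‖z'‖ ≤ 11 / 10 * ‖u‖ * (‖z‖ + ‖u‖ / 10) := by gcongr
  rw [norm_add_sq_real, h1]
  norm_num at h4
  nlinarith [sq_nonneg (‖u‖ - ‖z‖)]

/-! ### Prediction error on the good event. -/

section Deterministic

variable {n d : ℕ}

/-- The inner products of signed sums of `s` columns in `S` with signed sums of `s` columns
outside `S` are small. -/
def SparselyIncoherent (X : Matrix (Fin n) (Fin d) ℝ) (S : Finset (Fin d)) (s : ℕ) : Prop :=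
  ∀ (f : Fin s → S × Bool) (g : Fin s → (Sᶜ : Finset (Fin d)) × Bool),
    |inner ℝ (app (cols X S) (signedCoeff f)) (app (cols X Sᶜ) (signedCoeff g))| ≤
      0.01 * (‖app (cols X S) (signedCoeff f)‖ * ‖app (cols X Sᶜ) (signedCoeff g)‖)

lemma SparselyIncoherent.norm_sq_le {X : Matrix (Fin n) (Fin d) ℝ} {S : Finset (Fin d)} {s : ℕ}
    (hI : SparselyIncoherent X S s) (hs : 0 < s)
    (hX : ∀ j, ‖WithLp.toLp 2 (X.col j)‖ = √(n : ℝ)) {v : Fin d → ℝ}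
    (hv : 100 * l1 v ^ 2 * n ≤ s * ‖app (cols X S) (fun i => v i)‖ ^ 2) :
    ‖app (cols X S) (fun i => v i)‖ ^ 2 ≤ 2 * ‖app X v‖ ^ 2 := by
  have hs' : (0 : ℝ) < s := by exact_mod_cast hs
  rw [app_eq_cols_add_cols_compl X S v]
  set a : S → ℝ := fun i => v i with ha
  set b : (Sᶜ : Finset (Fin d)) → ℝ := fun i => v i with hb
  set u := app (cols X S) a with hu
  set z := app (cols X Sᶜ) b with hz
  have hal : l1 a ≤ l1 v := by
    rw [ha, l1_coe, ← l1On_add_compl S v]; linarith [l1On_nonneg Sᶜ v]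
  have hbl : l1 b ≤ l1 v := by
    rw [hb, l1_coe, ← l1On_add_compl S v]; linarith [l1On_nonneg S v]
  rcases le_or_gt (l1 a) 0 with ha0 | ha0
  · have : u = 0 := by rw [hu, l1_eq_zero ha0, app_zero]
    rw [this]; simp
  rcases le_or_gt (l1 b) 0 with hb0 | hb0
  · have : z = 0 := by rw [hz, l1_eq_zero hb0, app_zero]
    rw [this, add_zero]; nlinarith [sq_nonneg ‖u‖]
  -- Both Maurey errors are at most `‖v‖₁ √(n/s)`, which `hv` bounds by `‖u‖ / 10`.
  have key : ∀ {r t : ℝ}, 0 ≤ r → r ≤ l1 v → 0 ≤ t → t ^ 2 ≤ (r * √(n : ℝ)) ^ 2 / s →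
      t ≤ ‖u‖ / 10 := by
    intro r t hr hrv ht h
    rw [mul_pow, Real.sq_sqrt (Nat.cast_nonneg n), le_div_iff₀ hs'] at h
    have h1 : r ^ 2 ≤ l1 v ^ 2 := pow_le_pow_left₀ hr hrv 2
    have h2 : r ^ 2 * n ≤ l1 v ^ 2 * n := mul_le_mul_of_nonneg_right h1 (Nat.cast_nonneg n)
    refine abs_le_of_sq_le_sq' ?_ (by positivity) |>.2
    refine le_of_mul_le_mul_right ?_ hs'
    nlinarith
  obtain ⟨f, hf⟩ := exists_app_signedCoeff_approx (cols X S) (√(n : ℝ))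
    (fun i => (hX i).le) a ha0 hs
  obtain ⟨g, hg⟩ := exists_app_signedCoeff_approx (cols X Sᶜ) (√(n : ℝ))
    (fun i => (hX i).le) b hb0 hs
  refine norm_sq_le_two_mul_norm_add_sq (key ha0.le hal (norm_nonneg _) hf)
    (key hb0.le hbl (norm_nonneg _) hg) ?_
  have h := hI f g
  have h1 : 0 ≤ l1 a / s := by positivity
  have h2 : 0 ≤ l1 b / s := by positivity
  rw [inner_smul_left, inner_smul_right, norm_smul, norm_smul, abs_mul, abs_mul]
  simp only [Real.norm_eq_abs, abs_of_nonneg h1, abs_of_nonneg h2, RCLike.conj_to_real]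
  nlinarith [mul_le_mul_of_nonneg_left h (mul_nonneg h1 h2)]

/-- The basic inequality: compare the minimizer with the feasible point `β` and expand the square.
-/
lemma IsLasso.norm_sq_le {X : Matrix (Fin n) (Fin d) ℝ} {β b : Fin d → ℝ}
    {w : EuclideanSpace ℝ (Fin n)} (h : IsLasso X (app X β + w) (l1 β) b) :
    ‖app X (b - β)‖ ^ 2 ≤ 2 * inner ℝ (app X (b - β)) w := by
  have h1 := h.2 β le_rfl
  have h2 : app X β + w - app X b = w - app X (b - β) := by rw [app_sub]; abel
  rw [h2, add_sub_cancel_left, norm_sub_sq_real, real_inner_comm] at h1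
  linarith

lemma inner_app_le {X : Matrix (Fin n) (Fin d) ℝ} {w : EuclideanSpace ℝ (Fin n)} {Λ : ℝ}
    (h : ∀ j, |inner ℝ (WithLp.toLp 2 (X.col j)) w| ≤ Λ) (v : Fin d → ℝ) :
    inner ℝ (app X v) w ≤ Λ * l1 v := by
  rw [app_eq_sum, sum_inner, l1, l1On, Finset.mul_sum]
  refine Finset.sum_le_sum fun j _ => ?_
  rw [inner_smul_left, RCLike.conj_to_real]
  refine (le_abs_self _).trans ?_
  rw [abs_mul, mul_comm]
  exact mul_le_mul_of_nonneg_right (h j) (abs_nonneg _)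

/-- Test with a basis vector `e_i`, `i ∈ T`. The bound makes the constant finite and later ensures
that the sparsity level is positive. -/
lemma reConst_le_one {n : ℕ} (hn : 0 < n) {ι : Type*} [Fintype ι] [DecidableEq ι]
    {X : Matrix (Fin n) ι ℝ} (hX : ∀ j, ‖WithLp.toLp 2 (X.col j)‖ = √(n : ℝ)) {T : Finset ι}
    (hT : T.Nonempty) : reConst X T ≤ 1 := by
  obtain ⟨i, hi⟩ := hT
  have h1 : l2SqOn T (Pi.single i 1) = 1 := by
    simp [l2SqOn, Pi.single_apply, hi]
  have h2 : l1On T (Pi.single i 1) = 1 := by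
    simp [l1On, Pi.single_apply, hi, apply_ite]
  have h3 : l1On Tᶜ (Pi.single i 1) = 0 := by
    refine Finset.sum_eq_zero fun j hj => ?_
    have : j ≠ i := by rintro rfl; simp [hi] at hj
    simp [this]
  have h4 : (Pi.single i 1 : ι → ℝ) ∈ cone T := by
    change l1On _ _ ≤ l1On _ _
    rw [h2, h3]; exact zero_le_one
  refine (iInf₂_le (Pi.single i 1) ⟨h4, by rw [h1]; exact one_ne_zero⟩).trans ?_
  have hn' : (n : ℝ) ≠ 0 := by positivity
  rw [h1, app_single, hX, Real.sq_sqrt (Nat.cast_nonneg n)]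
  simp [hn']

lemma toReal_reConst_mul_le {n : ℕ} {ι : Type*} [Fintype ι] [DecidableEq ι]
    {X : Matrix (Fin n) ι ℝ} {T : Finset ι} {v : ι → ℝ} (hv : v ∈ cone T) :
    (reConst X T).toReal * l2SqOn T v ≤ 1 / (n : ℝ) * ‖app X v‖ ^ 2 := by
  by_cases h : l2SqOn T v = 0
  · rw [h, mul_zero]; positivity
  have hpos : 0 < l2SqOn T v := lt_of_le_of_ne (l2SqOn_nonneg T v) (Ne.symm h)
  have h1 : reConst X T ≤ ENNReal.ofReal ((1 / (n : ℝ) * ‖app X v‖ ^ 2) / l2SqOn T v) :=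
    iInf₂_le v ⟨hv, h⟩
  have h2 := ENNReal.toReal_le_of_le_ofReal (by positivity) h1
  exact (le_div_iff₀ hpos).1 h2

/-- The sparsity level used in the approximation of `X_S a` and `X_{Sᶜ} b`. -/
noncomputable def sparsity (c : ℝ) (n d : ℕ) : ℕ := ⌊c * n / (8 * Real.log d)⌋₊

/-- The deterministic core of the prediction error bound, for a real restricted eigenvalue
lower bound `γ`. -/
lemma IsLasso.error_le {c A K σ γ : ℝ} {k : ℕ} (hc : 0 < c) (hA : 0 < A)
    (hn : 1 ≤ n) (hd : 2 ≤ d) {X : Matrix (Fin n) (Fin d) ℝ} {S : Finset (Fin d)}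
    {β b : Fin d → ℝ} {w : EuclideanSpace ℝ (Fin n)}
    (hX : ∀ j, ‖WithLp.toLp 2 (X.col j)‖ = √(n : ℝ))
    (hI : SparselyIncoherent X S (sparsity c n d)) (hw : ‖w‖ ^ 2 ≤ K * σ ^ 2 * n) (hσ : 0 ≤ σ)
    (hK : 0 ≤ K)
    (hXw : ∀ j, |inner ℝ (WithLp.toLp 2 (X.col j)) w| ≤ σ * √(2 * (A + 2) * n * Real.log d))
    (hk : (supp β).card ≤ k) (hne : (supp β).Nonempty)
    (hγ : 0 < γ) (hγ1 : γ ≤ 1)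
    (hre : γ * l2SqOn (supp β) (b - β) ≤
      1 / (n : ℝ) * ‖app (cols X S) (fun i => (b - β) i)‖ ^ 2)
    (h : IsLasso X (app X β + w) (l1 β) b) :
    1 / (n : ℝ) * ‖app X (b - β)‖ ^ 2 ≤
      (25600 * K / c + 64 * (A + 2)) * (σ ^ 2 * (k * Real.log d)) / (γ * n) := by
  have hn' : (0 : ℝ) < n := by exact_mod_cast hn
  have hlog : 0 < Real.log d := Real.log_pos (by exact_mod_cast hd)
  have hk1 : (1 : ℝ) ≤ k := by exact_mod_cast (Finset.card_pos.2 hne).trans_le hk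
  have hcone : b - β ∈ cone (supp β) := sub_mem_cone_supp h.1
  have hbasic := h.norm_sq_le
  have hlin := inner_app_le hXw (b - β)
  set v := b - β with hv
  set u := app (cols X S) (fun i => v i) with hu
  set p := ‖app X v‖ with hp
  have hp0 : 0 ≤ p := norm_nonneg _
  have hl1 : 0 ≤ l1 v := l1On_nonneg _ _
  set L := Real.log d with hL
  have hl1sq : l1 v ^ 2 * (γ * n) ≤ 4 * k * ‖u‖ ^ 2 := by
    have h1 : l1 v ≤ 2 * l1On (supp β) v := by
      have h2 := l1On_add_compl (supp β) v
      have h3 : l1On (supp β)ᶜ v ≤ l1On (supp β) v := hcone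
      linarith
    have h4 : l1 v ^ 2 ≤ 4 * l1On (supp β) v ^ 2 := by nlinarith
    have h5 := l1On_sq_le (supp β) v
    have h6 : ((supp β).card : ℝ) * l2SqOn (supp β) v ≤ k * l2SqOn (supp β) v :=
      mul_le_mul_of_nonneg_right (by exact_mod_cast hk) (l2SqOn_nonneg _ _)
    have h7 : γ * n * l2SqOn (supp β) v ≤ ‖u‖ ^ 2 := by
      have := mul_le_mul_of_nonneg_left hre hn'.le
      rw [← mul_assoc (n : ℝ) (1 / n), mul_one_div_cancel hn'.ne'] at this
      linarith
    calc l1 v ^ 2 * (γ * n) ≤ 4 * (k * l2SqOn (supp β) v) * (γ * n) := by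
          gcongr; linarith
      _ = 4 * k * (γ * n * l2SqOn (supp β) v) := by ring
      _ ≤ 4 * k * ‖u‖ ^ 2 := by gcongr
  rw [le_div_iff₀ (by positivity), show 1 / (n : ℝ) * p ^ 2 * (γ * n) = p ^ 2 * γ by
    field_simp]
  -- The threshold is `6400 = 100 · 4 · 16`: the factor in `hcond`, the one in `hl1sq`, and the one
  -- in `hs16`. Below it the crude bound `p ≤ 2‖w‖` is enough.
  rcases lt_or_ge (c / 6400 * (γ * n)) (k * L) with hbad | hgood
  · have h1 : p ^ 2 ≤ 4 * ‖w‖ ^ 2 := by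
      have h2 : inner ℝ (app X v) w ≤ p * ‖w‖ := real_inner_le_norm _ _
      have h3 : p ≤ 2 * ‖w‖ := by
        by_contra! h4
        nlinarith [norm_nonneg w]
      nlinarith [norm_nonneg w]
    have h5 : p ^ 2 * γ ≤ 4 * (K * σ ^ 2) * (γ * n) := by nlinarith
    have h6 : γ * n ≤ 6400 / c * (k * L) := by
      rw [div_mul_eq_mul_div, le_div_iff₀ hc]; nlinarith
    calc p ^ 2 * γ ≤ 4 * (K * σ ^ 2) * (γ * n) := h5
      _ ≤ 4 * (K * σ ^ 2) * (6400 / c * (k * L)) := by gcongr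
      _ = 25600 * K / c * (σ ^ 2 * (k * L)) := by ring
      _ ≤ _ := by gcongr; linarith
  · set s := sparsity c n d with hs
    have hLk : L ≤ k * L := le_mul_of_one_le_left hlog.le hk1
    have hγn : γ * n ≤ n := mul_le_of_le_one_left hn'.le hγ1
    -- Since `k ≥ 1` and `γ ≤ 1`, the number under the floor is large, so rounding down loses at
    -- most a factor 2.
    have h8 : 8 ≤ c * n / (8 * L) := by
      rw [le_div_iff₀ (by positivity)]
      nlinarith
    have hs8 : c * n / (8 * L) < s + 1 := Nat.lt_floor_add_one _
    have hs16 : c * n ≤ 16 * L * s := by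
      have : c * n / (8 * L) ≤ 2 * s := by linarith
      rw [div_le_iff₀ (by positivity)] at this
      linarith
    have hs0 : 0 < s := by
      have : (0 : ℝ) < s := by linarith
      exact_mod_cast this
    have hcond : 100 * l1 v ^ 2 * n ≤ s * ‖u‖ ^ 2 := by
      have hpos : 0 < c * (γ * n) * (16 * L) := by positivity
      refine le_of_mul_le_mul_right ?_ hpos
      calc 100 * l1 v ^ 2 * n * (c * (γ * n) * (16 * L))
          = 1600 * L * (c * n) * (l1 v ^ 2 * (γ * n)) := by ring
        _ ≤ 1600 * L * (16 * L * s) * (4 * k * ‖u‖ ^ 2) := by gcongr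
        _ = 16 * L * s * ‖u‖ ^ 2 * (6400 * (k * L)) := by ring
        _ ≤ 16 * L * s * ‖u‖ ^ 2 * (c * (γ * n)) :=
          mul_le_mul_of_nonneg_left (by linarith) (by positivity)
        _ = _ := by ring
    have hup : ‖u‖ ^ 2 ≤ 2 * p ^ 2 := hI.norm_sq_le hs0 hX hcond
    set Λ := σ * √(2 * (A + 2) * n * L) with hΛ
    have hΛ2 : Λ ^ 2 = σ ^ 2 * (2 * (A + 2) * n * L) := by
      rw [hΛ, mul_pow, Real.sq_sqrt (by positivity)]
    have hΛ0 : 0 ≤ Λ := by positivity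
    have h9 : p ^ 2 ≤ 2 * (Λ * l1 v) := by linarith
    have h10 : (p ^ 2) ^ 2 ≤ 4 * Λ ^ 2 * l1 v ^ 2 := by
      have := pow_le_pow_left₀ (sq_nonneg p) h9 2
      linarith
    -- Squaring `h9` lets `‖v‖₁²` be replaced by a multiple of `p²`; the common factor `n * p ^ 2`
    -- is then cancelled, with `p = 0` treated apart.
    have h11 : (p ^ 2 * γ) * (n * p ^ 2) ≤ 64 * (A + 2) * (σ ^ 2 * (k * L)) * (n * p ^ 2) := by
      calc (p ^ 2 * γ) * (n * p ^ 2) = (p ^ 2) ^ 2 * (γ * n) := by ring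
        _ ≤ 4 * Λ ^ 2 * l1 v ^ 2 * (γ * n) := by gcongr
        _ = 4 * Λ ^ 2 * (l1 v ^ 2 * (γ * n)) := by ring
        _ ≤ 4 * Λ ^ 2 * (4 * k * (2 * p ^ 2)) :=
          mul_le_mul_of_nonneg_left (hl1sq.trans (by gcongr)) (by positivity)
        _ = _ := by rw [hΛ2]; ring
    have h12 : p ^ 2 * γ ≤ 64 * (A + 2) * (σ ^ 2 * (k * L)) := by
      rcases hp0.eq_or_lt with h0 | h0
      · rw [← h0]; norm_num; positivity
      · exact le_of_mul_le_mul_right h11 (by positivity)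
    refine h12.trans ?_
    have : 0 ≤ 25600 * K / c := by positivity
    gcongr
    linarith

/-- The deterministic prediction error bound, in terms of the restricted eigenvalue constant. -/
lemma IsLasso.ofReal_error_le {c A K σ : ℝ} {k : ℕ} (hc : 0 < c) (hA : 0 < A)
    (hn : 1 ≤ n) (hd : 2 ≤ d) {X : Matrix (Fin n) (Fin d) ℝ} {S : Finset (Fin d)}
    {β b : Fin d → ℝ} {w : EuclideanSpace ℝ (Fin n)}
    (hX : ∀ j, ‖WithLp.toLp 2 (X.col j)‖ = √(n : ℝ))
    (hI : SparselyIncoherent X S (sparsity c n d)) (hw : ‖w‖ ^ 2 ≤ K * σ ^ 2 * n) (hσ : 0 ≤ σ)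
    (hK : 0 ≤ K)
    (hXw : ∀ j, |inner ℝ (WithLp.toLp 2 (X.col j)) w| ≤ σ * √(2 * (A + 2) * n * Real.log d))
    (hk : (supp β).card ≤ k) (hS : supp β ⊆ S)
    (h : IsLasso X (app X β + w) (l1 β) b) :
    ENNReal.ofReal (1 / (n : ℝ) * ‖app X b - app X β‖ ^ 2) ≤
      ENNReal.ofReal ((25600 * K / c + 64 * (A + 2)) * (σ ^ 2 * (k * Real.log d))) /
        (reConst (cols X S) ((supp β).subtype (· ∈ S)) * n) := by
  rw [← app_sub]
  have hn' : (0 : ℝ) < n := by exact_mod_cast hn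
  have hlog : 0 < Real.log d := Real.log_pos (by exact_mod_cast hd)
  have hC : 0 < 25600 * K / c + 64 * (A + 2) := by positivity
  rcases (supp β).eq_empty_or_nonempty with hT | hT
  · have hβ : β = 0 := by
      funext i
      have : i ∉ supp β := by simp [hT]
      simpa [supp] using this
    have hb : b = 0 := l1_eq_zero (h.1.trans (by simp [hβ, l1, l1On]))
    simp [hβ, hb, app_zero]
  set G := reConst (cols X S) ((supp β).subtype (· ∈ S)) with hG
  have hG1 : G ≤ 1 := by
    refine reConst_le_one (X := cols X S) hn (fun j => hX j) ?_
    obtain ⟨i, hi⟩ := hT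
    exact ⟨⟨i, hS hi⟩, by simpa using hi⟩
  have hGtop : G ≠ ⊤ := ne_top_of_le_ne_top ENNReal.one_ne_top hG1
  -- For `G = 0` the quotient is `⊤` unless `σ = 0`; then `w = 0`, so the left side vanishes.
  rcases eq_or_ne G 0 with hG0 | hG0
  · rw [hG0, zero_mul]
    rcases hσ.eq_or_lt with hσ0 | hσ0
    · have hw0 : w = 0 := by
        rw [← hσ0] at hw
        have : ‖w‖ ^ 2 = 0 := le_antisymm (by simpa using hw) (sq_nonneg _)
        simpa using this
      have h0 := h.norm_sq_le
      rw [hw0, inner_zero_right, mul_zero] at h0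
      rw [le_antisymm h0 (sq_nonneg _)]
      simp
    · have hk1 : (1 : ℝ) ≤ k := by exact_mod_cast (Finset.card_pos.2 hT).trans_le hk
      rw [ENNReal.div_zero]
      · exact le_top
      · rw [Ne, ENNReal.ofReal_eq_zero, not_le]
        positivity
  · have hγ : 0 < G.toReal := ENNReal.toReal_pos hG0 hGtop
    have hre : G.toReal * l2SqOn (supp β) (b - β) ≤
        1 / (n : ℝ) * ‖app (cols X S) (fun i => (b - β) i)‖ ^ 2 := by
      have h1 := toReal_reConst_mul_le (X := cols X S)
        (mem_cone_restrict hS (sub_mem_cone_supp h.1))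
      have h2 : l2SqOn ((supp β).subtype (· ∈ S)) (fun i : S => (b - β) i) =
          l2SqOn (supp β) (b - β) := sum_subtype_of_subset hS fun i => (b - β) i ^ 2
      rwa [h2] at h1
    have h3 := h.error_le hc hA hn hd hX hI hw hσ hK hXw hk hT hγ
      (ENNReal.toReal_le_of_le_ofReal zero_le_one (by simpa using hG1)) hre
    refine (ENNReal.ofReal_le_ofReal h3).trans ?_
    rw [ENNReal.ofReal_div_of_pos (by positivity), ENNReal.ofReal_mul hγ.le,
      ENNReal.ofReal_toReal hGtop, ENNReal.ofReal_natCast]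

end Deterministic

/-! ### Gaussian tail bounds. -/

section Gaussian

/-- The characteristic functions agree, also in the degenerate case `σ = 0`. -/
lemma multivariateGaussian_zero_sq_smul_one {ι : Type*} [Fintype ι] [DecidableEq ι] (σ : ℝ) :
    multivariateGaussian 0 (σ ^ 2 • (1 : Matrix ι ι ℝ)) =
      (stdGaussian (EuclideanSpace ℝ ι)).map (fun x => σ • x) := by
  have hp : (σ ^ 2 • (1 : Matrix ι ι ℝ)).PosSemidef := Matrix.PosSemidef.one.smul (sq_nonneg σ)
  have hm : AEMeasurable (fun x : EuclideanSpace ℝ ι => σ • x)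
    (stdGaussian (EuclideanSpace ℝ ι)) := by fun_prop
  have := Measure.isProbabilityMeasure_map hm
  refine Measure.ext_of_charFun ?_
  ext t
  rw [charFun_multivariateGaussian hp, charFun_map_smul, charFun_stdGaussian, norm_smul, ← Complex.ofReal_pow,
    mul_pow, EuclideanSpace.real_norm_sq_eq t]
  congr 1
  simp only [Matrix.smul_mulVec, Matrix.one_mulVec, dotProduct, inner_zero_right,
    Real.norm_eq_abs, sq_abs]
  push_cast
  simp only [pow_two, zero_mul, zero_sub, neg_div, smul_eq_mul, Pi.smul_apply, Complex.ofReal_mul,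
    Finset.mul_sum]
  congr 2
  exact Finset.sum_congr rfl fun i _ => by ring

lemma integrable_exp_sq_div_four_gaussianReal :
    Integrable (fun x : ℝ => Real.exp (x ^ 2 / 4)) (gaussianReal 0 1) ∧
      ∫ x, Real.exp (x ^ 2 / 4) ∂(gaussianReal 0 1) = √2 := by
  have h : ∀ x : ℝ, gaussianPDFReal 0 1 x * Real.exp (x ^ 2 / 4) =
      (√(2 * Real.pi))⁻¹ * Real.exp (-(1 / 4) * x ^ 2) := by
    intro x
    rw [gaussianPDFReal, mul_assoc, ← Real.exp_add]
    simp only [NNReal.coe_one, mul_one, sub_zero]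
    congr 2
    ring
  constructor
  · rw [gaussianReal_of_var_ne_zero _ one_ne_zero,
      integrable_withDensity_iff_integrable_smul' (by fun_prop)
        (Filter.Eventually.of_forall fun x => by simp [gaussianPDF])]
    have h2 : (fun x => (gaussianPDF 0 1 x).toReal • Real.exp (x ^ 2 / 4)) =
        fun x => (√(2 * Real.pi))⁻¹ * Real.exp (-(1 / 4) * x ^ 2) := by
      funext x
      rw [toReal_gaussianPDF, smul_eq_mul, h]
    rw [h2]
    exact (integrable_exp_neg_mul_sq (by norm_num)).const_mul _
  · rw [integral_gaussianReal_eq_integral_smul one_ne_zero]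
    simp_rw [smul_eq_mul, h]
    rw [integral_const_mul, integral_gaussian, ← Real.sqrt_inv, ← Real.sqrt_mul (by positivity)]
    congr 1
    field_simp
    norm_num

/-- A chi-square tail bound. -/
lemma stdGaussian_lt_norm_sq_le {n : ℕ} (L : ℝ) :
    stdGaussian (EuclideanSpace ℝ (Fin n)) {g | 4 * (L + 1) * n < ‖g‖ ^ 2} ≤
      ENNReal.ofReal (Real.exp (-L * n)) := by
  rw [← map_pi_eq_stdGaussian, Measure.map_apply (by fun_prop)
    (measurableSet_lt measurable_const (by fun_prop))]
  obtain ⟨hi, hI⟩ := integrable_exp_sq_div_four_gaussianReal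
  set μ := Measure.pi (fun _ : Fin n => gaussianReal 0 1)
  have he : ∀ x : Fin n → ℝ, Real.exp (1 / 4 * ∑ i, x i ^ 2) = ∏ i, Real.exp (x i ^ 2 / 4) := by
    intro x
    rw [← Real.exp_sum, ← Finset.sum_div]
    congr 1; ring
  have hint : Integrable (fun x : Fin n → ℝ => Real.exp (1 / 4 * ∑ i, x i ^ 2)) μ := by
    simp_rw [he]
    exact Integrable.fintype_prod (f := fun _ x => Real.exp (x ^ 2 / 4)) fun _ => hi
  have hmgf : mgf (fun x : Fin n → ℝ => ∑ i, x i ^ 2) μ (1 / 4) = √2 ^ n := by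
    rw [mgf]
    simp_rw [he]
    rw [integral_fintype_prod_eq_prod (f := fun _ x => Real.exp (x ^ 2 / 4))]
    simp [hI]
  -- Chernoff at parameter `1/4`: the factor `exp (-(L + 1) n)` absorbs the moment generating
  -- function `√2 ^ n ≤ exp n`.
  have h := measure_ge_le_exp_mul_mgf (μ := μ) (4 * (L + 1) * n) (by norm_num) hint
  rw [hmgf] at h
  have h2 : √2 ^ n ≤ Real.exp n := by
    rw [← Real.exp_one_pow]
    refine pow_le_pow_left₀ (Real.sqrt_nonneg _) ?_ n
    rw [Real.sqrt_le_left (Real.exp_pos 1).le]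
    nlinarith [Real.add_one_le_exp 1]
  have h3 : μ.real {x | 4 * (L + 1) * n ≤ ∑ i, x i ^ 2} ≤ Real.exp (-L * n) := by
    refine (h.trans (mul_le_mul_of_nonneg_left h2 (Real.exp_pos _).le)).trans ?_
    rw [← Real.exp_add]
    refine Real.exp_le_exp.2 (le_of_eq ?_)
    ring
  refine (measure_mono ?_).trans
    ((ENNReal.le_ofReal_iff_toReal_le (measure_ne_top _ _) (Real.exp_pos _).le).2 h3)
  intro x hx
  simp only [Set.mem_preimage, Set.mem_ofPred_eq, EuclideanSpace.real_norm_sq_eq] at hx ⊢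
  exact hx.le

lemma stdGaussian_lt_abs_inner_le {n : ℕ} (x : EuclideanSpace ℝ (Fin n)) {t : ℝ} (ht : 0 ≤ t) :
    stdGaussian (EuclideanSpace ℝ (Fin n)) {g | t < |inner ℝ x g|} ≤
      ENNReal.ofReal (2 * Real.exp (-t ^ 2 / (2 * ‖x‖ ^ 2))) := by
  set μ := stdGaussian (EuclideanSpace ℝ (Fin n))
  have hlaw : μ.map (innerSL ℝ x) = gaussianReal 0 (‖x‖ ^ 2).toNNReal := by
    rw [IsGaussian.map_eq_gaussianReal, integral_strongDual_stdGaussian,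
      variance_dual_stdGaussian, innerSL_apply_norm]
  have hsub : ∀ v : NNReal, HasSubgaussianMGF id v (gaussianReal 0 v) := fun v =>
    ⟨fun t => integrable_exp_mul_gaussianReal t, fun t => by
      rw [mgf_id_gaussianReal]; simp⟩
  have h1 := (hsub (‖x‖ ^ 2).toNNReal).measure_ge_le ht
  have h2 := (hsub (‖x‖ ^ 2).toNNReal).neg.measure_ge_le ht
  rw [Real.coe_toNNReal _ (sq_nonneg _)] at h1 h2
  have hset : {g | t < |inner ℝ x g|} = (innerSL ℝ x) ⁻¹' {r : ℝ | t < |r|} := rfl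
  rw [hset, ← Measure.map_apply (by fun_prop) (measurableSet_lt (by fun_prop) (by fun_prop)), hlaw,
    ENNReal.le_ofReal_iff_toReal_le (measure_ne_top _ _) (by positivity)]
  calc (gaussianReal 0 (‖x‖ ^ 2).toNNReal).real {r : ℝ | t < |r|}
      ≤ (gaussianReal 0 (‖x‖ ^ 2).toNNReal).real ({r : ℝ | t ≤ id r} ∪ {r : ℝ | t ≤ (-id) r}) := by
        refine measureReal_mono ?_
        intro r (hr : t < |r|)
        rcases lt_abs.1 hr with h | h
        · exact Or.inl h.le
        · exact Or.inr h.le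
    _ ≤ _ := (measureReal_union_le _ _).trans (add_le_add h1 h2)
    _ = _ := by ring

end Gaussian

/-! ### Noise of variance `σ²` independent of the design. -/

section IndependentNoise

variable {Ω : Type*} [MeasurableSpace Ω] {P : Measure Ω} {n : ℕ}

lemma measure_lt_norm_sq_le {w : Ω → EuclideanSpace ℝ (Fin n)} {σ : ℝ}
    (hw : HasLaw w (multivariateGaussian 0 (σ ^ 2 • (1 : Matrix (Fin n) (Fin n) ℝ))) P) (L : ℝ) :
    P {ω | 4 * (L + 1) * σ ^ 2 * n < ‖w ω‖ ^ 2} ≤ ENNReal.ofReal (Real.exp (-L * n)) := by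
  have hm : MeasurableSet {x : EuclideanSpace ℝ (Fin n) | 4 * (L + 1) * σ ^ 2 * n < ‖x‖ ^ 2} :=
    measurableSet_lt measurable_const (by fun_prop)
  rw [hw.measure_eq (p := fun x => 4 * (L + 1) * σ ^ 2 * n < ‖x‖ ^ 2) hm,
    multivariateGaussian_zero_sq_smul_one σ, Measure.map_apply (by fun_prop) hm]
  refine (measure_mono ?_).trans (stdGaussian_lt_norm_sq_le L)
  intro g hg
  simp only [Set.preimage_ofPred_eq, Set.mem_ofPred_eq, norm_smul, mul_pow, Real.norm_eq_abs,
    sq_abs] at hg ⊢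
  by_contra! h
  nlinarith [mul_le_mul_of_nonneg_left h (sq_nonneg σ)]

/-- By independence the joint law is a product, so Fubini fixes `Z = x` and the standard Gaussian
tail applies. The condition `‖Z ω‖ = R` sits inside the event because the norm is not assumed
constant. -/
lemma measure_lt_abs_inner_le [IsProbabilityMeasure P]
    {w : Ω → EuclideanSpace ℝ (Fin n)} {σ : ℝ} (hσ : 0 ≤ σ)
    (hw : HasLaw w (multivariateGaussian 0 (σ ^ 2 • (1 : Matrix (Fin n) (Fin n) ℝ))) P)
    {Z : Ω → EuclideanSpace ℝ (Fin n)} (hZ : Measurable Z) (hZw : IndepFun Z w P)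
    (R : ℝ) {t : ℝ} (ht : 0 ≤ t) :
    P {ω | ‖Z ω‖ = R ∧ σ * t < |inner ℝ (Z ω) (w ω)|} ≤
      ENNReal.ofReal (2 * Real.exp (-t ^ 2 / (2 * R ^ 2))) := by
  set B : Set (EuclideanSpace ℝ (Fin n) × EuclideanSpace ℝ (Fin n)) :=
    {p | ‖p.1‖ = R ∧ σ * t < |inner ℝ p.1 p.2|} with hB
  have hBm : MeasurableSet B :=
    MeasurableSet.inter
      (s₁ := {p : EuclideanSpace ℝ (Fin n) × EuclideanSpace ℝ (Fin n) | ‖p.1‖ = R})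
      (s₂ := {p | σ * t < |inner ℝ p.1 p.2|})
      (measurableSet_eq_fun (by fun_prop) measurable_const)
      (measurableSet_lt measurable_const (by fun_prop))
  have h1 : P {ω | ‖Z ω‖ = R ∧ σ * t < |inner ℝ (Z ω) (w ω)|} =
      P.map (fun ω => (Z ω, w ω)) B := by
    rw [Measure.map_apply_of_aemeasurable (hZ.aemeasurable.prodMk hw.aemeasurable) hBm]
    rfl
  have := Measure.isProbabilityMeasure_map (μ := P) hZ.aemeasurable
  rw [h1, (indepFun_iff_map_prod_eq_prod_map_map hZ.aemeasurable hw.aemeasurable).1 hZw, hw.map_eq,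
    Measure.prod_apply hBm]
  refine (lintegral_mono (g := fun _ => ENNReal.ofReal (2 * Real.exp (-t ^ 2 / (2 * R ^ 2))))
    fun x => ?_).trans (by simp)
  by_cases hx : ‖x‖ = R
  · have hm : MeasurableSet (Prod.mk x ⁻¹' B) := measurable_prodMk_left hBm
    rw [multivariateGaussian_zero_sq_smul_one σ, Measure.map_apply (by fun_prop) hm, ← hx]
    refine (measure_mono ?_).trans (stdGaussian_lt_abs_inner_le x ht)
    intro g hg
    obtain ⟨-, hg⟩ := hg
    simp only [Set.mem_ofPred_eq, inner_smul_right, abs_mul, abs_of_nonneg hσ] at hg ⊢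
    exact lt_of_mul_lt_mul_left hg hσ
  · have : Prod.mk x ⁻¹' B = ∅ := by
      ext g; simp [hB, hx]
    simp [this]

end IndependentNoise

/-! ### Union bounds over sparse sums and over columns. -/

section RandomDesign

variable {Ω : Type*} [MeasurableSpace Ω] {P : Measure Ω} {n d : ℕ}

lemma abs_inner_le_of_abs_inner_normalize_le {H : Type*} [NormedAddCommGroup H]
    [InnerProductSpace ℝ H] {u z : H} {ε : ℝ} (h : |inner ℝ (‖u‖⁻¹ • u) (‖z‖⁻¹ • z)| ≤ ε) :
    |inner ℝ u z| ≤ ε * (‖u‖ * ‖z‖) := by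
  rcases eq_or_ne u 0 with rfl | hu
  · simp
  rcases eq_or_ne z 0 with rfl | hz
  · simp
  have hu' : 0 < ‖u‖ := norm_pos_iff.2 hu
  have hz' : 0 < ‖z‖ := norm_pos_iff.2 hz
  rw [inner_smul_left, inner_smul_right, RCLike.conj_to_real, ← mul_assoc, abs_mul,
    abs_of_pos (by positivity), ← mul_inv, ← div_eq_inv_mul, div_le_iff₀ (by positivity)] at h
  exact h

/-- Union bound over the signed sums of `sparsity c n d` columns. -/
lemma IsPartiallyRotated.measure_not_sparselyIncoherent_le
    {X : Ω → Matrix (Fin n) (Fin d) ℝ} {S : Finset (Fin d)} {c : ℝ} (hc : 0 < c) (hd : 2 ≤ d)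
    (h : IsPartiallyRotated P X S 0.01 c) :
    P {ω | ¬ SparselyIncoherent (X ω) S (sparsity c n d)} ≤
      ENNReal.ofReal (Real.exp (-(c / 2) * n)) := by
  have hlog : 0 < Real.log d := Real.log_pos (by exact_mod_cast hd)
  have hd0 : (0 : ℝ) < d := by positivity
  have hd2 : (2 : ℝ) ≤ d := by exact_mod_cast hd
  set s := sparsity c n d with hs
  have hsub : {ω | ¬ SparselyIncoherent (X ω) S s} ⊆
      ⋃ fg : (Fin s → S × Bool) × (Fin s → (Sᶜ : Finset (Fin d)) × Bool),
        {ω | 0.01 < |inner ℝ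
          (‖app (cols (X ω) S) (signedCoeff fg.1)‖⁻¹ • app (cols (X ω) S) (signedCoeff fg.1))
          (‖app (cols (X ω) Sᶜ) (signedCoeff fg.2)‖⁻¹ •
            app (cols (X ω) Sᶜ) (signedCoeff fg.2))|} := by
    intro ω hω
    by_contra hcon
    refine hω fun f g => abs_inner_le_of_abs_inner_normalize_le ?_
    by_contra! hlt
    exact hcon (Set.mem_iUnion.2 ⟨(f, g), hlt⟩)
  refine (measure_mono hsub).trans ((measure_iUnion_fintype_le _ _).trans
    ((Finset.sum_le_sum fun fg _ => h (signedCoeff fg.1) (signedCoeff fg.2)).trans ?_))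
  rw [Finset.sum_const, Finset.card_univ, nsmul_eq_mul, ← ENNReal.ofReal_natCast,
    ← ENNReal.ofReal_mul (Nat.cast_nonneg _)]
  refine ENNReal.ofReal_le_ofReal ?_
  -- Since `d ≥ 2`, one extra factor `d` absorbs the choice of sign; the pairs then number at most
  -- `d ^ (4 * s)`, whence the `8` in `sparsity`.
  have hcard : ∀ U : Finset (Fin d), ((U.card * 2 : ℕ) : ℝ) ≤ d ^ 2 := by
    intro U
    have : (U.card : ℝ) ≤ d := by
      exact_mod_cast (Finset.card_le_univ U).trans_eq (Fintype.card_fin d)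
    push_cast
    nlinarith
  have hcount : ((Fintype.card ((Fin s → S × Bool) × (Fin s → (Sᶜ : Finset (Fin d)) × Bool)) : ℕ) :
      ℝ) ≤ Real.exp (c / 2 * n) := by
    simp only [Fintype.card_prod, Fintype.card_pi, Fintype.card_bool, Fintype.card_coe,
      Finset.prod_const, Finset.card_univ, Fintype.card_fin, Nat.cast_mul _ (_ ^ s), Nat.cast_pow]
    calc ((S.card * 2 : ℕ) : ℝ) ^ s * ((Sᶜ.card * 2 : ℕ) : ℝ) ^ s
        ≤ ((d : ℝ) ^ 2) ^ s * ((d : ℝ) ^ 2) ^ s := by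
          gcongr
          · exact hcard S
          · exact hcard Sᶜ
      _ = Real.exp (Real.log d * (4 * s)) := by
          rw [← mul_pow, ← pow_add, ← pow_mul, Real.exp_mul, Real.exp_log hd0,
            ← Real.rpow_natCast]
          push_cast
          norm_num
      _ ≤ Real.exp (c / 2 * n) := by
          refine Real.exp_le_exp.2 ?_
          have h1 : (s : ℝ) ≤ c * n / (8 * Real.log d) := Nat.floor_le (by positivity)
          rw [le_div_iff₀ (by positivity)] at h1
          linarith
  refine (mul_le_mul_of_nonneg_right hcount (Real.exp_pos _).le).trans (le_of_eq ?_)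
  rw [← Real.exp_add]
  congr 1
  ring

lemma measure_exists_lt_abs_inner_col_le [IsProbabilityMeasure P] {A σ : ℝ} (hA : 0 < A)
    (hσ : 0 ≤ σ) (hn : 1 ≤ n) (hd : 2 ≤ d) {X : Ω → Matrix (Fin n) (Fin d) ℝ}
    {w : Ω → EuclideanSpace ℝ (Fin n)} (hX : ∀ i j, Measurable fun ω => X ω i j)
    (hw : HasLaw w (multivariateGaussian 0 (σ ^ 2 • (1 : Matrix (Fin n) (Fin n) ℝ))) P)
    (hind : IndepFun (fun ω (p : Fin n × Fin d) => X ω p.1 p.2) w P) :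
    P {ω | ∃ j, ‖WithLp.toLp 2 ((X ω).col j)‖ = √(n : ℝ) ∧
        σ * √(2 * (A + 2) * n * Real.log d) < |inner ℝ (WithLp.toLp 2 ((X ω).col j)) (w ω)|} ≤
      ENNReal.ofReal ((d : ℝ) ^ (-A)) := by
  have hn' : (0 : ℝ) < n := by exact_mod_cast hn
  have hlog : 0 < Real.log d := Real.log_pos (by exact_mod_cast hd)
  have hd0 : (0 : ℝ) < d := by positivity
  have hd2 : (2 : ℝ) ≤ d := by exact_mod_cast hd
  set t := √(2 * (A + 2) * n * Real.log d) with ht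
  -- The `+ 2` in the exponent pays for the union over `d` columns and for the factor 2, as `2 / d ≤
  -- 1`.
  have hbound : 2 * Real.exp (-t ^ 2 / (2 * √(n : ℝ) ^ 2)) = 2 * (d : ℝ) ^ (-(A + 2)) := by
    rw [ht, Real.sq_sqrt (by positivity), Real.sq_sqrt hn'.le, Real.rpow_def_of_pos hd0]
    congr 2
    field_simp
  have hset : {ω | ∃ j, ‖WithLp.toLp 2 ((X ω).col j)‖ = √(n : ℝ) ∧
        σ * t < |inner ℝ (WithLp.toLp 2 ((X ω).col j)) (w ω)|} ⊆
      ⋃ j, {ω | ‖WithLp.toLp 2 ((X ω).col j)‖ = √(n : ℝ) ∧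
        σ * t < |inner ℝ (WithLp.toLp 2 ((X ω).col j)) (w ω)|} :=
    fun ω ⟨j, hj⟩ => Set.mem_iUnion.2 ⟨j, hj⟩
  refine (measure_mono hset).trans ((measure_iUnion_fintype_le _ _).trans
    ((Finset.sum_le_sum (g := fun _ => ENNReal.ofReal (2 * (d : ℝ) ^ (-(A + 2))))
      fun j _ => ?_).trans ?_))
  · rw [← hbound]
    refine measure_lt_abs_inner_le (Z := fun ω => WithLp.toLp 2 ((X ω).col j)) hσ hw ?_ ?_ _
      (Real.sqrt_nonneg _)
    · exact (PiLp.continuous_toLp 2 _).measurable.comp (measurable_pi_lambda _ fun i => hX i j)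
    · refine hind.comp (φ := fun x : Fin n × Fin d → ℝ => WithLp.toLp 2 fun i => x (i, j))
        (ψ := id) ?_ measurable_id
      exact (PiLp.continuous_toLp 2 _).measurable.comp
        (measurable_pi_lambda _ fun i => measurable_pi_apply _)
  · rw [Finset.sum_const, Finset.card_univ, Fintype.card_fin, nsmul_eq_mul,
      ← ENNReal.ofReal_natCast, ← ENNReal.ofReal_mul hd0.le]
    refine ENNReal.ofReal_le_ofReal ?_
    rw [neg_add, Real.rpow_add hd0, Real.rpow_neg hd0.le 2, Real.rpow_two]
    have h1 : (d : ℝ) * (2 * (d ^ (-A) * ((d : ℝ) ^ 2)⁻¹)) = d ^ (-A) * (2 / d) := by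
      field_simp
    rw [h1]
    exact mul_le_of_le_one_right (by positivity) ((div_le_one hd0).2 hd2)

end RandomDesign

/-- Factor out `x ^ n` and use `x ^ n + (1 - x) ^ n ≤ x + (1 - x)`, which needs `n ≥ 1`. It merges
two exponential failure probabilities into one with no prefactor. -/
lemma sq_pow_add_mul_one_sub_pow_le {x : ℝ} (hx0 : 0 < x) (hx1 : x < 1) {n : ℕ} (hn : 1 ≤ n) :
    (x ^ 2) ^ n + (x * (1 - x)) ^ n ≤ x ^ n := by
  have h1 : x ^ n ≤ x := pow_le_of_le_one hx0.le hx1.le (by omega)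
  have h2 : (1 - x) ^ n ≤ 1 - x := pow_le_of_le_one (by linarith) (by linarith) (by omega)
  rw [← pow_mul, mul_comm 2 n, pow_mul, mul_pow]
  nlinarith [pow_pos hx0 n]

end PartiallyRotated

/-- The exceptional event (some Lasso estimate violates the bound) has outer probability at most
`d ^ (-A) + exp (-c' n)`. The quotient on the right-hand side of the bound is taken in `[0, ∞]`. -/
theorem corollary1p4 :
    ∀ c : ℝ, 0 < c → ∃ c' : ℝ, 0 < c' ∧ ∀ A : ℝ, 0 < A → ∃ C : ℝ, 0 < C ∧
      ∀ (n d k : ℕ), 1 ≤ n → 2 ≤ d →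
      ∀ (Ω : Type*) [MeasurableSpace Ω] (P : Measure Ω) [IsProbabilityMeasure P]
        (X : Ω → Matrix (Fin n) (Fin d) ℝ) (S : Finset (Fin d)) (β : Fin d → ℝ) (σ : ℝ)
        (w y : Ω → EuclideanSpace ℝ (Fin n)),
        (∀ i j, Measurable fun ω => X ω i j) →
        (∀ᵐ ω ∂P, ∀ j, ‖WithLp.toLp 2 ((X ω).col j)‖ = √(n : ℝ)) →
        PartiallyRotated.IsPartiallyRotated P X S 0.01 c →
        0 ≤ σ →
        HasLaw w (multivariateGaussian 0 (σ ^ 2 • (1 : Matrix (Fin n) (Fin n) ℝ))) P →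
        IndepFun (fun ω (p : Fin n × Fin d) => X ω p.1 p.2) w P →
        (∀ ω, y ω = PartiallyRotated.app (X ω) β + w ω) →
        (PartiallyRotated.supp β).card ≤ k →
        PartiallyRotated.supp β ⊆ S →
        P {ω | ¬ ∀ b : Fin d → ℝ,
            PartiallyRotated.IsLasso (X ω) (y ω) (PartiallyRotated.l1 β) b →
            ENNReal.ofReal (1 / (n : ℝ) *
                ‖PartiallyRotated.app (X ω) b - PartiallyRotated.app (X ω) β‖ ^ 2)
              ≤ ENNReal.ofReal (C * (σ ^ 2 * (k * Real.log d))) /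
                (PartiallyRotated.reConst (PartiallyRotated.cols (X ω) S)
                  ((PartiallyRotated.supp β).subtype (· ∈ S)) * n)}
          ≤ ENNReal.ofReal ((d : ℝ) ^ (-A) + Real.exp (-c' * n)) := by
  intro c hc
  refine ⟨c / 4, by positivity, fun A hA => ?_⟩
  set x := Real.exp (-(c / 4)) with hx
  have hx0 : 0 < x := Real.exp_pos _
  have hx1 : x < 1 := Real.exp_lt_one_iff.2 (by linarith)
  have hx2 : 0 < x * (1 - x) := mul_pos hx0 (by linarith)
  -- Chosen so that `exp (-L) = x * (1 - x)`: the noise tail then fits in what `x ^ n` leaves after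
  -- the incoherence failure `(x ^ 2) ^ n`. It depends on `c` only.
  set L := -Real.log (x * (1 - x)) with hL
  have hL0 : 0 ≤ L := by
    have := Real.log_nonpos hx2.le (by nlinarith)
    linarith
  refine ⟨25600 * (4 * (L + 1)) / c + 64 * (A + 2), by positivity, ?_⟩
  intro n d k hn hd Ω _ P _ X S β σ w y hXm hX hrot hσ hw hind hy hk hS
  have hE2 := hrot.measure_not_sparselyIncoherent_le hc hd
  have hE3 := PartiallyRotated.measure_lt_norm_sq_le hw L
  have hE4 := PartiallyRotated.measure_exists_lt_abs_inner_col_le hA hσ hn hd hXm hw hind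
  set N := {ω | ¬ ∀ j, ‖WithLp.toLp 2 ((X ω).col j)‖ = √(n : ℝ)} with hN
  have hE1 : P N = 0 := hX
  set E2 := {ω | ¬ PartiallyRotated.SparselyIncoherent (X ω) S (PartiallyRotated.sparsity c n d)} with hE2d
  set E3 := {ω | 4 * (L + 1) * σ ^ 2 * n < ‖w ω‖ ^ 2} with hE3d
  set E4 := {ω | ∃ j, ‖WithLp.toLp 2 ((X ω).col j)‖ = √(n : ℝ) ∧
        σ * √(2 * (A + 2) * n * Real.log d) < |inner ℝ (WithLp.toLp 2 ((X ω).col j)) (w ω)|}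
    with hE4d
  calc _ ≤ P (N ∪ (E4 ∪ (E2 ∪ E3))) := by
        refine measure_mono fun ω hω => ?_
        by_contra hcon
        simp only [Set.mem_union, not_or] at hcon
        obtain ⟨h1, h4, h2, h3⟩ := hcon
        have h1' : ∀ j, ‖WithLp.toLp 2 ((X ω).col j)‖ = √(n : ℝ) := not_not.1 h1
        refine hω fun b hb => ?_
        rw [hy ω] at hb
        refine hb.ofReal_error_le hc hA hn hd h1' (not_not.1 h2) (not_lt.1 h3) hσ (by positivity)
          (fun j => ?_) hk hS
        by_contra! hj
        exact h4 ⟨j, h1' j, hj⟩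
    _ ≤ P N + (P E4 + (P E2 + P E3)) :=
        (measure_union_le _ _).trans (add_le_add le_rfl ((measure_union_le _ _).trans
          (add_le_add le_rfl (measure_union_le _ _))))
    _ ≤ 0 + (ENNReal.ofReal ((d : ℝ) ^ (-A)) + (ENNReal.ofReal (Real.exp (-(c / 2) * n)) +
          ENNReal.ofReal (Real.exp (-L * n)))) :=
        add_le_add hE1.le (add_le_add hE4 (add_le_add hE2 hE3))
    _ = ENNReal.ofReal ((d : ℝ) ^ (-A) + (Real.exp (-(c / 2) * n) + Real.exp (-L * n))) := by
        rw [zero_add, ← ENNReal.ofReal_add (Real.exp_pos _).le (Real.exp_pos _).le,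
          ← ENNReal.ofReal_add (by positivity) (by positivity)]
    _ ≤ _ := by
        refine ENNReal.ofReal_le_ofReal (add_le_add le_rfl ?_)
        have e1 : Real.exp (-(c / 2) * n) = (x ^ 2) ^ n := by
          rw [hx, ← Real.exp_nat_mul, ← Real.exp_nat_mul]; congr 1; push_cast; ring
        have e2 : Real.exp (-L * n) = (x * (1 - x)) ^ n := by
          rw [hL, neg_neg, mul_comm, Real.exp_nat_mul, Real.exp_log hx2]
        have e3 : Real.exp (-(c / 4) * n) = x ^ n := by
          rw [hx, ← Real.exp_nat_mul, mul_comm]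
        rw [e1, e2, e3]
        exact PartiallyRotated.sq_pow_add_mul_one_sub_pow_le hx0 hx1 hn
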